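/- Let $N$ be an integer, let $L\ge 1$ be an integer, and let $f$ be a real-valued function with four continuous derivatives on $[N+1,N+L]$. Suppose there are constants $W_4>1$ and $\lambda_4\ge 1$ such that $$\frac{1}{W_4}\le |f^{(4)}(x)|\le \frac{\lambda_4}{W_4}\qquad (N+1\le x\le N+L).$$ Then for all real numbers $\eta_3>0$ and $\eta_4>0$, writing $S(L)=\sum_{n=N+1}^{N+L}e^{2\pi i f(n)}$, we have $$|S(L)|^2\le \left(LW_4^{-1/7}+\eta_4\right)\left(\alpha_4L+\gamma_4\sqrt{L}\,W_4^{2/7}+\beta_4W_4^{3/7}\right),$$ where $$\alpha_4=\frac1{\eta_4}+\frac{72}{91}\sqrt{\widetilde\alpha_3}\,\bigl(\eta_4+W_4^{-1/7}\bigr)^{1/6},\qquad \gamma_4=\frac{72}{55}\sqrt{\widetilde\beta_3}\,\eta_4^{-1/6}+\sqrt{\eta_3\widetilde\alpha_3}\,W_4^{-1/7},\qquad \beta_4=\frac{18}{20}\sqrt{\widetilde\beta_3\,\eta_3}\,\eta_4^{-1/3},$$ and $$\widetilde\alpha_3=\frac1{\eta_3}+\frac{32\lambda_4}{15\sqrt\pi}\sqrt{\eta_3+1}+2\lambda_4\eta_3+2\lambda_4,\qquad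 \widetilde\beta_3=\frac{64}{3\sqrt\pi\sqrt{\eta_3}}+4.$$ -/

import Mathlib

noncomputable section

namespace FourthDerivativeTest

/-- The exponential sum `S(L) = ∑_{n=N+1}^{N+L} e^{2π i f(n)}`. -/
def expSum (f : ℝ → ℝ) (N : ℤ) (L : ℕ) : ℂ :=
  ∑ n ∈ Finset.Icc (N + 1) (N + (L : ℤ)), Complex.exp (2 * Real.pi * Complex.I * (f (n : ℝ) : ℂ))

/-- `α̃₃ = 1/η₃ + (32 lam / (15 √π)) √(η₃ + 1) + 2 lam η₃ + 2 lam`. -/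
def alpha3Tilde (η₃ lam : ℝ) : ℝ :=
  1 / η₃ + 32 * lam / (15 * √Real.pi) * √(η₃ + 1) + 2 * lam * η₃ + 2 * lam

/-- `β̃₃ = 64 / (3 √π √η₃) + 4`. -/
def beta3Tilde (η₃ : ℝ) : ℝ :=
  64 / (3 * √Real.pi * √η₃) + 4

/-- `α₄ = 1/η₄ + (72/91) √α̃₃ (η₄ + W^{-1/7})^{1/6}`. -/
def alpha4 (η₃ η₄ lam W : ℝ) : ℝ :=
  1 / η₄ + 72 / 91 * √(alpha3Tilde η₃ lam) * (η₄ + W ^ (-(1 / 7) : ℝ)) ^ (1 / 6 : ℝ)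

/-- `γ₄ = (72/55) √β̃₃ η₄^{-1/6} + √(η₃ α̃₃) W^{-1/7}`. -/
def gamma4 (η₃ η₄ lam W : ℝ) : ℝ :=
  72 / 55 * √(beta3Tilde η₃) * η₄ ^ (-(1 / 6) : ℝ)
    + √(η₃ * alpha3Tilde η₃ lam) * W ^ (-(1 / 7) : ℝ)

/-- `β₄ = (18/20) √(β̃₃ η₃) η₄^{-1/3}`. -/
def beta4 (η₃ η₄ : ℝ) : ℝ :=
  18 / 20 * √(beta3Tilde η₃ * η₃) * η₄ ^ (-(1 / 3) : ℝ)

end FourthDerivativeTest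

end

/-!
The proof works with finite differences of the phases instead of derivatives. By the mean value
theorem the fourth differences of `n ↦ f (N + 1 + n)` lie between `1 / W₄` and `lam₄ / W₄`, up to a
common sign, and the sequence of phases can be continued beyond the summation range with this
property kept (`exists_seq_of_contDiffOn`). After that no domain conditions are left: if the
`(k + 1)`-th differences of `a` lie in `[1 / W, lam / W]`, then the `k`-th differences of
`a (· + m) - a` lie in the same kind of interval with `W / m` in place of `W`.

The bounds climb from second to fourth differences. The second-difference test cuts the range into
blocks on which the first difference stays in one unit interval `[k - δ, k + 1 - δ)`, and applies the
Kusmin–Landau inequality where it is at distance at least `δ` from the integers. Each further step is the Weyl–van der Corput inequality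
`norm_seqSum_sq_le` with `⌈X⌉` shifts, where `X = η₃ W ^ (1/3)` for third differences of size
`1 / W` and `X = η₄ W₄ ^ (1/7)` for the fourth ones. The fractions `72/91`, `72/55`, `9/5` are the
values of `2 ∫₀¹ (1 - x) x ^ s dx = 2 / ((s + 1) (s + 2))` at `s = 1/6, -1/6, -1/3`; the sums over
the shifts are at most these integrals, by monotonicity for `s ≤ 0` and by concavity for `s > 0`.

Taking the square root of the third-difference bound by subadditivity gives four terms, and the last
of them would lead to `9/5` in `β₄`. The constant `18/20` is half of that. The missing factor comes
from `norm_seqSum_le_of_third_fwdDiff`: the square root of `(p² + q²) (r² + s²)` is at most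
`p r + p s + q r + q s / 2` unless `p` is small against `q`, which happens only for sums shorter than
a multiple of `η₃ W ^ (1/3)`; for these the trivial bound, or the third-difference test with a
smaller parameter, is at least as good.
-/

namespace FourthDerivativeTest

open Finset
open scoped fwdDiff

/-! ### Phases and exponential sums -/

/-- The additive character `e(x) = exp(2πix)` of the real line. -/
noncomputable def expPhase (x : ℝ) : ℂ := Complex.exp (2 * Real.pi * Complex.I * (x : ℂ))

/-- The exponential sum `∑_{n < L} e(a n)` attached to a sequence of phases. -/
noncomputable def seqSum (a : ℕ → ℝ) (L : ℕ) : ℂ := ∑ n ∈ range L, expPhase (a n)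

lemma norm_expPhase (x : ℝ) : ‖expPhase x‖ = 1 := by
  have : 2 * Real.pi * Complex.I * (x : ℂ) = ((2 * Real.pi * x : ℝ) : ℂ) * Complex.I := by
    push_cast; ring
  rw [expPhase, this, Complex.norm_exp_ofReal_mul_I]

lemma expPhase_add (x y : ℝ) : expPhase (x + y) = expPhase x * expPhase y := by
  simp only [expPhase, ← Complex.exp_add]
  congr 1; push_cast; ring

lemma conj_expPhase (x : ℝ) : (starRingEnd ℂ) (expPhase x) = expPhase (-x) := by
  simp only [expPhase, ← Complex.exp_conj]
  congr 1; simp [map_ofNat]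

lemma expPhase_sub (x y : ℝ) : expPhase (x - y) = expPhase x * (starRingEnd ℂ) (expPhase y) := by
  rw [sub_eq_add_neg, expPhase_add, conj_expPhase]

lemma norm_seqSum_neg (a : ℕ → ℝ) (L : ℕ) : ‖seqSum (-a) L‖ = ‖seqSum a L‖ := by
  have : seqSum (-a) L = (starRingEnd ℂ) (seqSum a L) := by
    simp [seqSum, map_sum, conj_expPhase]
  rw [this, RCLike.norm_conj]

lemma norm_sum_expPhase_le_card (s : Finset ℕ) (a : ℕ → ℝ) :
    ‖∑ n ∈ s, expPhase (a n)‖ ≤ (#s : ℝ) := by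
  refine (norm_sum_le _ _).trans ?_
  simp [norm_expPhase]

lemma norm_seqSum_le (a : ℕ → ℝ) (L : ℕ) : ‖seqSum a L‖ ≤ (L : ℝ) := by
  simpa [seqSum] using norm_sum_expPhase_le_card (range L) a

/-! ### The Kusmin–Landau inequality -/

/-- The summation-by-parts weight: `c = (1 + i cot φ)/2` is the inverse of `1 - e^{2iφ}`. -/
noncomputable def landauWeight (φ : ℝ) : ℂ :=
  (1 + Complex.I * ((Real.cos φ / Real.sin φ : ℝ) : ℂ)) / 2

lemma one_sub_exp_mul_landauWeight {φ : ℝ} (h : Real.sin φ ≠ 0) :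
    (1 - Complex.exp (2 * φ * Complex.I)) * landauWeight φ = 1 := by
  have hs : Complex.sin φ ≠ 0 := by exact_mod_cast h
  have h2 := Complex.sin_sq_add_cos_sq (φ : ℂ)
  have h1 : Complex.exp (2 * φ * Complex.I) =
      1 - 2 * Complex.sin φ ^ 2 + 2 * Complex.cos φ * Complex.sin φ * Complex.I := by
    have : Complex.exp (2 * φ * Complex.I) =
        (Complex.cos φ + Complex.sin φ * Complex.I) ^ 2 := by
      rw [← Complex.exp_mul_I, ← Complex.exp_nat_mul]; congr 1; push_cast; ring
    rw [this]
    linear_combination (Complex.sin φ) ^ 2 * Complex.I_sq + h2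
  have h3 : landauWeight φ =
      (Complex.sin φ + Complex.I * Complex.cos φ) / (2 * Complex.sin φ) := by
    rw [landauWeight]; push_cast; field_simp
  rw [h1, h3, mul_div_assoc', div_eq_one_iff_eq (by simpa using hs)]
  linear_combination 2 * Complex.sin φ * h2 - 2 * Complex.cos φ ^ 2 * Complex.sin φ * Complex.I_sq

lemma norm_landauWeight {φ : ℝ} (h0 : 0 < φ) (h1 : φ < Real.pi) :
    ‖landauWeight φ‖ = 1 / (2 * Real.sin φ) := by
  have hs := Real.sin_pos_of_pos_of_lt_pi h0 h1
  have h2 := Real.sin_sq_add_cos_sq φ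
  have : ‖landauWeight φ‖ ^ 2 = (1 / (2 * Real.sin φ)) ^ 2 := by
    have hr : ∀ r : ℝ, Complex.normSq ((1 + Complex.I * (r : ℂ)) / 2) = (1 + r ^ 2) / 4 := by
      intro r
      rw [Complex.normSq_div, Complex.normSq_apply, Complex.normSq_ofNat]
      simp
      ring
    rw [← Complex.normSq_eq_norm_sq, landauWeight, hr]
    field_simp
    linear_combination 4 * h2
  exact (sq_eq_sq₀ (norm_nonneg _) (by positivity)).1 this

lemma norm_landauWeight_sub (φ ψ : ℝ) : ‖landauWeight φ - landauWeight ψ‖ =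
    |Real.cos φ / Real.sin φ - Real.cos ψ / Real.sin ψ| / 2 := by
  have : landauWeight φ - landauWeight ψ =
      Complex.I * ((Real.cos φ / Real.sin φ - Real.cos ψ / Real.sin ψ : ℝ) : ℂ) / 2 := by
    simp only [landauWeight]; push_cast; ring
  rw [this]
  simp [-Complex.ofReal_sub]

lemma cos_div_sin_anti {φ ψ : ℝ} (h0 : 0 < φ) (h : φ ≤ ψ) (h1 : ψ < Real.pi) :
    Real.cos ψ / Real.sin ψ ≤ Real.cos φ / Real.sin φ := by
  have hs := Real.sin_pos_of_pos_of_lt_pi h0 (h.trans_lt h1)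
  have hs' := Real.sin_pos_of_pos_of_lt_pi (h0.trans_le h) h1
  have := Real.sin_nonneg_of_nonneg_of_le_pi (sub_nonneg.2 h) (by linarith : ψ - φ ≤ Real.pi)
  rw [Real.sin_sub] at this
  rw [div_le_div_iff₀ hs' hs]
  linarith

/-- `cot (φ / 2) ≤ 2 / φ`, written in terms of the full angle. -/
lemma one_add_cos_div_sin_le {φ : ℝ} (h0 : 0 < φ) (h1 : φ < Real.pi) :
    (1 + Real.cos φ) / Real.sin φ ≤ 2 / φ := by
  have hs := Real.sin_pos_of_pos_of_lt_pi h0 h1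
  have hc : 0 < Real.cos (φ / 2) := Real.cos_pos_of_mem_Ioo ⟨by linarith, by linarith⟩
  have ht := Real.le_tan (by linarith : 0 ≤ φ / 2) (by linarith : φ / 2 < Real.pi / 2)
  rw [Real.tan_eq_sin_div_cos, le_div_iff₀ hc] at ht
  have e : φ = 2 * (φ / 2) := by ring
  rw [div_le_div_iff₀ hs h0]
  rw [e, Real.cos_two_mul, Real.sin_two_mul, ← e]
  nlinarith

/-- **Kusmin–Landau inequality** for a block starting at the index `0`. -/
lemma norm_seqSum_le_of_fwdDiff_mem {a : ℕ → ℝ} {K : ℕ} {k δ : ℝ} (hk : expPhase k = 1)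
    (hδ : 0 < δ) (hmono : Monotone (Δ_[1] a))
    (hmem : ∀ n < K, Δ_[1] a n ∈ Set.Icc (k + δ) (k + 1 - δ)) :
    ‖seqSum a K‖ ≤ 2 / (Real.pi * δ) := by
  rcases K with _ | K
  · simp only [seqSum, range_zero, sum_empty, norm_zero]; positivity
  have hpi := Real.pi_pos
  set φ : ℕ → ℝ := fun n => Real.pi * (Δ_[1] a n - k) with hφ
  have hφ1 : ∀ n ≤ K, Real.pi * δ ≤ φ n := fun n hn =>
    mul_le_mul_of_nonneg_left (by linarith [(hmem n (by omega)).1]) hpi.le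
  have hφ2 : ∀ n ≤ K, φ n ≤ Real.pi - Real.pi * δ := fun n hn => by
    have := mul_le_mul_of_nonneg_left (a := Real.pi)
      (by linarith [(hmem n (by omega)).2] : Δ_[1] a n - k ≤ 1 - δ) hpi.le
    simp only [hφ]; linarith
  have hpd : 0 < Real.pi * δ := by positivity
  have hpos : ∀ n ≤ K, 0 < φ n := fun n hn => hpd.trans_le (hφ1 n hn)
  have hlt : ∀ n ≤ K, φ n < Real.pi := fun n hn => by linarith [hφ2 n hn]
  have hmonoφ : ∀ n, φ n ≤ φ (n + 1) := fun n =>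
    mul_le_mul_of_nonneg_left (by linarith [hmono (Nat.le_succ n)]) hpi.le
  have hstep : ∀ n, expPhase (a (n + 1)) = expPhase (a n) * Complex.exp (2 * φ n * Complex.I) := by
    intro n
    have e1 : a (n + 1) = a n + (Δ_[1] a n - k) + k := by simp only [fwdDiff]; ring
    have e2 : Complex.exp (2 * φ n * Complex.I) = expPhase (Δ_[1] a n - k) := by
      simp only [expPhase, hφ]; congr 1; push_cast; ring
    rw [e2, e1, expPhase_add, expPhase_add, hk, mul_one]
  have hz : ∀ n ≤ K, expPhase (a n) =
      (expPhase (a n) - expPhase (a (n + 1))) * landauWeight (φ n) := by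
    intro n hn
    have := one_sub_exp_mul_landauWeight (Real.sin_pos_of_pos_of_lt_pi (hpos n hn) (hlt n hn)).ne'
    rw [hstep n]
    linear_combination (-expPhase (a n)) * this
  -- Summation by parts: each step contributes one difference of weights, and these telescope.
  have key : ∀ J ≤ K, ‖seqSum a (J + 1) + expPhase (a (J + 1)) * landauWeight (φ J)‖ ≤
      1 / (2 * Real.sin (φ 0)) + (Real.cos (φ 0) / Real.sin (φ 0) -
        Real.cos (φ J) / Real.sin (φ J)) / 2 := by
    intro J
    induction J with
    | zero =>
      intro hJ
      have : seqSum a (0 + 1) + expPhase (a (0 + 1)) * landauWeight (φ 0) =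
          expPhase (a 0) * landauWeight (φ 0) := by
        simp only [seqSum, zero_add, sum_range_one]
        linear_combination hz 0 hJ
      rw [this, norm_mul, norm_expPhase, norm_landauWeight (hpos 0 hJ) (hlt 0 hJ)]
      simp
    | succ J ih =>
      intro hJ
      have hb := ih (by omega)
      have e : seqSum a (J + 1 + 1) + expPhase (a (J + 1 + 1)) * landauWeight (φ (J + 1)) =
          (seqSum a (J + 1) + expPhase (a (J + 1)) * landauWeight (φ J)) +
          expPhase (a (J + 1)) * (landauWeight (φ (J + 1)) - landauWeight (φ J)) := by
        have := hz (J + 1) hJ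
        simp only [seqSum, sum_range_succ _ (J + 1)]
        linear_combination this
      rw [e]
      refine (norm_add_le _ _).trans ?_
      rw [norm_mul, norm_expPhase, one_mul, norm_landauWeight_sub, abs_of_nonpos
        (sub_nonpos.2 (cos_div_sin_anti (hpos J (by omega)) (hmonoφ J) (hlt _ hJ)))]
      linarith
  have hK := key K le_rfl
  have h3 : ‖seqSum a (K + 1)‖ ≤ ‖seqSum a (K + 1) + expPhase (a (K + 1)) * landauWeight (φ K)‖ +
      1 / (2 * Real.sin (φ K)) := by
    have := norm_sub_le (seqSum a (K + 1) + expPhase (a (K + 1)) * landauWeight (φ K))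
      (expPhase (a (K + 1)) * landauWeight (φ K))
    rwa [add_sub_cancel_right, norm_mul, norm_expPhase, one_mul,
      norm_landauWeight (hpos K le_rfl) (hlt K le_rfl)] at this
  have h4 := one_add_cos_div_sin_le (hpos 0 (Nat.zero_le K)) (hlt 0 (Nat.zero_le K))
  have h5 := one_add_cos_div_sin_le (φ := Real.pi - φ K) (by linarith [hlt K le_rfl])
    (by linarith [hpos K le_rfl])
  rw [Real.cos_pi_sub, Real.sin_pi_sub] at h5
  have h6 : 2 / φ 0 ≤ 2 / (Real.pi * δ) :=
    div_le_div_of_nonneg_left (by norm_num) hpd (hφ1 0 (Nat.zero_le K))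
  have h7 : 2 / (Real.pi - φ K) ≤ 2 / (Real.pi * δ) :=
    div_le_div_of_nonneg_left (by norm_num) hpd (by linarith [hφ2 K le_rfl])
  have e8 : 1 / (2 * Real.sin (φ 0)) = 1 / Real.sin (φ 0) / 2 := by rw [div_div, mul_comm]
  have e9 : 1 / (2 * Real.sin (φ K)) = 1 / Real.sin (φ K) / 2 := by rw [div_div, mul_comm]
  rw [add_div] at h4 h5
  rw [neg_div] at h5
  linarith

/-- Kusmin–Landau for an arbitrary block of consecutive indices. -/
lemma norm_sum_Ico_expPhase_le {a : ℕ → ℝ} {s t : ℕ} {k : ℤ} {δ : ℝ} (hδ : 0 < δ)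
    (hmono : Monotone (Δ_[1] a))
    (hmem : ∀ n ∈ Ico s t, Δ_[1] a n ∈ Set.Icc ((k : ℝ) + δ) (k + 1 - δ)) :
    ‖∑ n ∈ Ico s t, expPhase (a n)‖ ≤ 2 / (Real.pi * δ) := by
  have hk : expPhase (k : ℝ) = 1 := by
    rw [expPhase]
    convert Complex.exp_int_mul_two_pi_mul_I k using 2
    push_cast; ring
  rw [sum_Ico_eq_sum_range]
  refine norm_seqSum_le_of_fwdDiff_mem (a := fun n => a (s + n)) (K := t - s) hk hδ ?_ ?_
  · intro m n hmn
    exact hmono (Nat.add_le_add_left hmn s)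
  · intro n hn
    exact hmem (s + n) (by simp only [mem_Ico]; omega)

/-! ### The second-difference test -/

lemma exists_eq_Ico_of_ordConnected {s : Finset ℕ}
    (h : ∀ x ∈ s, ∀ y ∈ s, ∀ z, x ≤ z → z ≤ y → z ∈ s) : ∃ b c, s = Ico b c := by
  rcases s.eq_empty_or_nonempty with rfl | hs
  · exact ⟨0, 0, by simp⟩
  · refine ⟨s.min' hs, s.max' hs + 1, ?_⟩
    ext n
    simp only [mem_Ico, Nat.lt_succ_iff]
    exact ⟨fun hn => ⟨s.min'_le n hn, s.le_max' n hn⟩,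
      fun hn => h _ (s.min'_mem hs) _ (s.max'_mem hs) n hn.1 hn.2⟩

lemma mul_le_sub_of_forall_le_fwdDiff {θ : ℕ → ℝ} {c : ℝ} (h : ∀ n, c ≤ Δ_[1] θ n) (m j : ℕ) :
    j * c ≤ θ (m + j) - θ m := by
  induction j with
  | zero => simp
  | succ j ih =>
    have := h (m + j)
    simp only [fwdDiff] at this
    push_cast
    rw [← add_assoc]; linarith

lemma sub_le_mul_of_forall_fwdDiff_le {θ : ℕ → ℝ} {c : ℝ} (h : ∀ n, Δ_[1] θ n ≤ c) (m j : ℕ) :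
    θ (m + j) - θ m ≤ j * c := by
  induction j with
  | zero => simp
  | succ j ih =>
    have := h (m + j)
    simp only [fwdDiff] at this
    push_cast
    rw [← add_assoc]; linarith

/-- The indices whose first difference is within `δ` of an integer contribute trivially,
the others by Kusmin–Landau. -/
lemma norm_sum_block_le {a : ℕ → ℝ} {K : ℕ} {k : ℤ} {δ W : ℝ} (hδ : 0 < δ) (hW : 0 < W)
    (h : ∀ n, 1 / W ≤ Δ_[1] (Δ_[1] a) n) :
    ‖∑ n ∈ range K with ⌊Δ_[1] a n + δ⌋ = k, expPhase (a n)‖ ≤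
      2 * δ * W + 1 + 2 / (Real.pi * δ) := by
  set θ := Δ_[1] a with hθ
  have hmono : Monotone θ := monotone_nat_of_le_succ fun n => by
    have h1 := h n
    have : 0 < 1 / W := by positivity
    simp only [fwdDiff] at h1 ⊢
    linarith
  rw [← sum_filter_add_sum_filter_not _ (fun n => θ n < k + δ)]
  refine (norm_add_le _ _).trans (add_le_add ?_ ?_)
  · obtain ⟨b, c, hbc⟩ := exists_eq_Ico_of_ordConnected
      (s := {n ∈ {n ∈ range K | ⌊θ n + δ⌋ = k} | θ n < k + δ}) (by
        simp only [mem_filter, mem_range, Int.floor_eq_iff]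
        intro x hx y hy z hxz hzy
        have := hmono hxz
        have := hmono hzy
        exact ⟨⟨by omega, by linarith, by linarith⟩, by linarith⟩)
    rw [hbc]
    refine (norm_sum_expPhase_le_card _ _).trans ?_
    rw [Nat.card_Ico]
    rcases Nat.lt_or_ge b c with hlt | hge
    · have hmem : ∀ n ∈ Ico b c, k - δ ≤ θ n ∧ θ n < k + δ := by
        rw [← hbc]
        simp only [mem_filter, mem_range, Int.floor_eq_iff]
        intro n hn
        exact ⟨by linarith, hn.2⟩
      have h1 := hmem b (by simp only [mem_Ico]; omega)
      have h2 := hmem (c - 1) (by simp only [mem_Ico]; omega)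
      have h3 := mul_le_sub_of_forall_le_fwdDiff h b (c - 1 - b)
      rw [show b + (c - 1 - b) = c - 1 by omega] at h3
      have h4 : ((c - 1 - b : ℕ) : ℝ) * (1 / W) ≤ 2 * δ := by linarith
      rw [mul_one_div, div_le_iff₀ hW] at h4
      rw [show c - b = (c - 1 - b) + 1 by omega]
      push_cast
      linarith
    · rw [Nat.sub_eq_zero_of_le hge]; push_cast; positivity
  · obtain ⟨b, c, hbc⟩ := exists_eq_Ico_of_ordConnected
      (s := {n ∈ {n ∈ range K | ⌊θ n + δ⌋ = k} | ¬ θ n < k + δ}) (by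
        simp only [mem_filter, mem_range, Int.floor_eq_iff]
        intro x hx y hy z hxz hzy
        have := hmono hxz
        have := hmono hzy
        exact ⟨⟨by omega, by linarith, by linarith⟩, by linarith⟩)
    rw [hbc]
    refine norm_sum_Ico_expPhase_le (k := k) hδ hmono ?_
    rw [← hbc]
    simp only [mem_filter, mem_range, Int.floor_eq_iff, not_lt]
    intro n hn
    exact ⟨hn.2, by linarith [hn.1.2.2]⟩

/-- **Second-difference test**. The first differences sweep through at most `lam K / W + 2`
unit intervals; the half-width `δ = 1 / √(πW)` balances the two contributions in each of them. -/
lemma norm_seqSum_le_of_second_fwdDiff {a : ℕ → ℝ} {W lam : ℝ} (hW : 0 < W) (hlam : 1 ≤ lam)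
    (h : ∀ n, (Δ_[1])^[2] a n ∈ Set.Icc (1 / W) (lam / W)) (K : ℕ) :
    ‖seqSum a K‖ ≤ (lam * K / W + 2) * (4 * (√W / √Real.pi) + 1) := by
  have hpi := Real.pi_pos
  set v := √W with hv
  set p := √Real.pi with hp
  have hv0 : 0 < v := Real.sqrt_pos.2 hW
  have hp0 : 0 < p := Real.sqrt_pos.2 hpi
  have hv2 : v ^ 2 = W := Real.sq_sqrt hW.le
  have hp2 : p ^ 2 = Real.pi := Real.sq_sqrt hpi.le
  rcases K with _ | K
  · simp only [seqSum, range_zero, sum_empty, norm_zero]; positivity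
  set δ := 1 / (p * v) with hδ
  have hδ0 : 0 < δ := by positivity
  set θ := Δ_[1] a with hθ
  have h1 : ∀ n, 1 / W ≤ Δ_[1] θ n := fun n => (h n).1
  have h2 : ∀ n, Δ_[1] θ n ≤ lam / W := fun n => (h n).2
  have hmono : Monotone θ := monotone_nat_of_le_succ fun n => by
    have h1 := h1 n
    have : 0 < 1 / W := by positivity
    simp only [fwdDiff] at h1
    linarith
  have hmaps : ∀ n ∈ range (K + 1), ⌊θ n + δ⌋ ∈ Icc ⌊θ 0 + δ⌋ ⌊θ K + δ⌋ := by
    intro n hn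
    simp only [mem_range] at hn
    simp only [mem_Icc]
    exact ⟨Int.floor_le_floor (by linarith [hmono (Nat.zero_le n)]),
      Int.floor_le_floor (by linarith [hmono (Nat.lt_succ_iff.1 hn)])⟩
  rw [seqSum, ← sum_fiberwise_of_maps_to hmaps]
  refine (norm_sum_le_of_le _ fun k _ => norm_sum_block_le (K := K + 1) (k := k) hδ0 hW h1).trans ?_
  rw [sum_const, nsmul_eq_mul]
  have hB : 2 * δ * W + 1 + 2 / (Real.pi * δ) = 4 * (v / p) + 1 := by
    rw [← hv2, ← hp2, hδ]; field_simp; ring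
  rw [hB]
  refine mul_le_mul_of_nonneg_right ?_ (by positivity)
  have hle : ⌊θ 0 + δ⌋ ≤ ⌊θ K + δ⌋ := Int.floor_le_floor (by linarith [hmono (Nat.zero_le K)])
  have hc : ((#(Icc ⌊θ 0 + δ⌋ ⌊θ K + δ⌋) : ℕ) : ℝ) = ⌊θ K + δ⌋ + 1 - ⌊θ 0 + δ⌋ := by
    rw [Int.card_Icc, ← Int.cast_natCast, Int.toNat_of_nonneg (by omega)]
    push_cast; ring
  rw [hc]
  have h5 := Int.floor_le (θ K + δ)
  have h6 := Int.lt_floor_add_one (θ 0 + δ)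
  have h7 := sub_le_mul_of_forall_fwdDiff_le h2 0 K
  rw [zero_add] at h7
  have h8 : (K : ℝ) * (lam / W) ≤ lam * (K + 1 : ℕ) / W := by
    rw [mul_div_assoc', mul_comm]
    refine div_le_div_of_nonneg_right ?_ hW.le
    push_cast; nlinarith
  linarith

/-! ### Weyl–van der Corput differencing -/

/-- Counting the pairs `(i, j)` by their distance. -/
lemma sum_sum_dist_eq (r : ℕ → ℝ) (M : ℕ) :
    ∑ i ∈ range M, ∑ j ∈ range M, r (Nat.dist i j) =
      M * r 0 + 2 * ∑ m ∈ Ico 1 M, ((M : ℝ) - m) * r m := by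
  induction M with
  | zero => simp
  | succ M ih =>
    have e1 : ∑ i ∈ range M, r (Nat.dist i M) = ∑ m ∈ Ico 1 (M + 1), r m := by
      rw [← sum_range_reflect, sum_Ico_eq_sum_range]
      refine sum_congr (by simp) fun i hi => ?_
      simp only [mem_range] at hi
      congr 1
      simp only [Nat.dist]; omega
    have e2 : ∑ i ∈ range M, r (Nat.dist M i) = ∑ m ∈ Ico 1 (M + 1), r m := by
      rw [← e1]; exact sum_congr rfl fun i _ => by rw [Nat.dist_comm]
    have e3 : ∑ m ∈ Ico 1 (M + 1), (((M + 1 : ℕ) : ℝ) - m) * r m =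
        ∑ m ∈ Ico 1 M, ((M : ℝ) - m) * r m + ∑ m ∈ Ico 1 (M + 1), r m := by
      have : ∑ m ∈ Ico 1 M, ((M : ℝ) - m) * r m = ∑ m ∈ Ico 1 (M + 1), ((M : ℝ) - m) * r m := by
        rcases M with _ | M
        · simp
        · rw [sum_Ico_succ_top (by omega : 1 ≤ M + 1)]; simp
      rw [this, ← sum_add_distrib]
      exact sum_congr rfl fun m _ => by push_cast; ring
    simp only [sum_range_succ, sum_add_distrib]
    rw [e1, e2, e3, ih, Nat.dist_self]
    push_cast; ring

/-- The `L` terms `e(a 0), …, e(a (L - 1))` placed at the indices `i, …, i + L - 1`, and `0` at all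
other indices. -/
noncomputable def windowed (a : ℕ → ℝ) (L i k : ℕ) : ℂ :=
  if i ≤ k ∧ k < i + L then expPhase (a (k - i)) else 0

lemma sum_windowed (a : ℕ → ℝ) {L M i : ℕ} (hi : i < M) :
    ∑ k ∈ range (L + M - 1), windowed a L i k = seqSum a L := by
  have : ∑ k ∈ range (L + M - 1), windowed a L i k = ∑ k ∈ Ico i (i + L), windowed a L i k := by
    symm
    refine sum_subset (fun k hk => ?_) fun k _ hk => ?_
    · simp only [mem_Ico, mem_range] at hk ⊢; omega
    · simp only [mem_Ico] at hk
      rw [windowed, if_neg hk]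
  rw [this, sum_Ico_eq_sum_range, Nat.add_sub_cancel_left, seqSum]
  refine sum_congr rfl fun n hn => ?_
  simp only [mem_range] at hn
  rw [windowed, if_pos (by omega), Nat.add_sub_cancel_left]

lemma sum_windowed_mul_conj (a : ℕ → ℝ) {L M i m : ℕ} (hi : i + m < M) :
    ∑ k ∈ range (L + M - 1), windowed a L i k * (starRingEnd ℂ) (windowed a L (i + m) k) =
      seqSum (Δ_[m] a) (L - m) := by
  have : ∑ k ∈ range (L + M - 1), windowed a L i k * (starRingEnd ℂ) (windowed a L (i + m) k) =
      ∑ k ∈ Ico (i + m) (i + m + (L - m)),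
        windowed a L i k * (starRingEnd ℂ) (windowed a L (i + m) k) := by
    symm
    refine sum_subset (fun k hk => ?_) fun k _ hk => ?_
    · simp only [mem_Ico, mem_range] at hk ⊢; omega
    · simp only [mem_Ico] at hk
      by_cases h1 : i ≤ k ∧ k < i + L
      · rw [windowed, windowed, if_neg (c := i + m ≤ k ∧ k < i + m + L) (by omega), map_zero,
          mul_zero]
      · rw [windowed, if_neg h1, zero_mul]
  rw [this, sum_Ico_eq_sum_range, Nat.add_sub_cancel_left, seqSum]
  refine sum_congr rfl fun n hn => ?_
  simp only [mem_range] at hn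
  rw [windowed, windowed, if_pos (by omega), if_pos (by omega), Nat.add_sub_cancel_left,
    ← expPhase_sub, fwdDiff, show i + m + n - i = n + m by omega]

lemma norm_sum_windowed_mul_conj (a : ℕ → ℝ) {L M i j : ℕ} (hi : i < M) (hj : j < M) :
    ‖∑ k ∈ range (L + M - 1), windowed a L i k * (starRingEnd ℂ) (windowed a L j k)‖ =
      ‖seqSum (Δ_[Nat.dist i j] a) (L - Nat.dist i j)‖ := by
  rcases Nat.le_total i j with h | h
  · obtain ⟨m, rfl⟩ := Nat.exists_eq_add_of_le h
    rw [sum_windowed_mul_conj a hj, show Nat.dist i (i + m) = m by simp only [Nat.dist]; omega]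
  · obtain ⟨m, rfl⟩ := Nat.exists_eq_add_of_le h
    rw [show Nat.dist (j + m) j = m by simp only [Nat.dist]; omega,
      ← sum_windowed_mul_conj a hi, ← RCLike.norm_conj, map_sum]
    congr 1
    refine sum_congr rfl fun k _ => ?_
    rw [map_mul, Complex.conj_conj, mul_comm]

/-- **Weyl–van der Corput inequality**: Cauchy–Schwarz applied to the average of `M` shifts. -/
lemma norm_seqSum_sq_le (a : ℕ → ℝ) (L : ℕ) {M : ℕ} (hM : 0 < M) :
    ‖seqSum a L‖ ^ 2 ≤ (L + M - 1) / M *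
      (L + 2 * ∑ m ∈ Ico 1 M, (1 - (m : ℝ) / M) * ‖seqSum (Δ_[m] a) (L - m)‖) := by
  have hM' : (0 : ℝ) < M := by exact_mod_cast hM
  set w := windowed a L
  have e1 : (M : ℂ) * seqSum a L = ∑ k ∈ range (L + M - 1), ∑ i ∈ range M, w i k := by
    rw [sum_comm, sum_congr rfl fun i hi => sum_windowed a (mem_range.1 hi)]
    simp
  have e2 : ∑ k ∈ range (L + M - 1), ‖∑ i ∈ range M, w i k‖ ^ 2 ≤
      ∑ i ∈ range M, ∑ j ∈ range M,
        ‖seqSum (Δ_[Nat.dist i j] a) (L - Nat.dist i j)‖ := by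
    have : ((∑ k ∈ range (L + M - 1), ‖∑ i ∈ range M, w i k‖ ^ 2 : ℝ) : ℂ) =
        ∑ i ∈ range M, ∑ j ∈ range M,
          ∑ k ∈ range (L + M - 1), w i k * (starRingEnd ℂ) (w j k) := by
      push_cast
      simp_rw [← Complex.mul_conj', map_sum, sum_mul_sum]
      rw [sum_comm]
      exact sum_congr rfl fun i _ => sum_comm
    have hn : ∑ k ∈ range (L + M - 1), ‖∑ i ∈ range M, w i k‖ ^ 2 =
        ‖((∑ k ∈ range (L + M - 1), ‖∑ i ∈ range M, w i k‖ ^ 2 : ℝ) : ℂ)‖ := by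
      rw [Complex.norm_real, Real.norm_of_nonneg (sum_nonneg fun _ _ => sq_nonneg _)]
    rw [hn, this]
    refine norm_sum_le_of_le _ fun i hi => norm_sum_le_of_le _ fun j hj => ?_
    exact (norm_sum_windowed_mul_conj a (mem_range.1 hi) (mem_range.1 hj)).le
  rw [sum_sum_dist_eq (fun m => ‖seqSum (Δ_[m] a) (L - m)‖)] at e2
  have e3 : (M * ‖seqSum a L‖) ^ 2 ≤
      (L + M - 1) * ∑ k ∈ range (L + M - 1), ‖∑ i ∈ range M, w i k‖ ^ 2 := by
    have h1 : M * ‖seqSum a L‖ ≤ ∑ k ∈ range (L + M - 1), ‖∑ i ∈ range M, w i k‖ := by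
      have : M * ‖seqSum a L‖ = ‖(M : ℂ) * seqSum a L‖ := by simp
      rw [this, e1]
      exact norm_sum_le _ _
    have h2 := sq_sum_le_card_mul_sum_sq (s := range (L + M - 1))
      (f := fun k => ‖∑ i ∈ range M, w i k‖)
    rw [card_range, Nat.cast_sub (by omega)] at h2
    push_cast at h2
    exact (pow_le_pow_left₀ (by positivity) h1 2).trans h2
  have e4 : ‖seqSum (Δ_[0] a) (L - 0)‖ = L := by
    simp [seqSum, fwdDiff, expPhase]
  rw [e4] at e2
  have hL : (0 : ℝ) ≤ L + M - 1 := by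
    have : (1 : ℝ) ≤ M := by exact_mod_cast hM
    have : (0 : ℝ) ≤ L := by positivity
    linarith
  have e5 : ∑ m ∈ Ico 1 M, ((M : ℝ) - m) * ‖seqSum (Δ_[m] a) (L - m)‖ =
      M * ∑ m ∈ Ico 1 M, (1 - (m : ℝ) / M) * ‖seqSum (Δ_[m] a) (L - m)‖ := by
    rw [mul_sum]
    exact sum_congr rfl fun m _ => by field_simp
  rw [e5] at e2
  have e6 := e3.trans (mul_le_mul_of_nonneg_left e2 hL)
  rw [div_mul_eq_mul_div, le_div_iff₀ hM']
  refine le_of_mul_le_mul_left ?_ hM'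
  linarith

/-! ### Differences of a differenced sequence -/

lemma fwdDiff_iter_fwdDiff_mem {a : ℕ → ℝ} {k : ℕ} {W lam : ℝ}
    (h : ∀ n, (Δ_[1])^[k + 1] a n ∈ Set.Icc (1 / W) (lam / W)) (m n : ℕ) :
    (Δ_[1])^[k] (Δ_[m] a) n ∈ Set.Icc (1 / (W / m)) (lam / (W / m)) := by
  have hc : Function.Commute (fwdDiff 1 : (ℕ → ℝ) → ℕ → ℝ) (fwdDiff m) := by
    intro b
    funext x
    simp only [fwdDiff, add_right_comm x m 1]
    ring
  rw [show (Δ_[1])^[k] (Δ_[m] a) = Δ_[m] ((Δ_[1])^[k] a) from (hc.iterate_left k) a]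
  have h' : ∀ n, Δ_[1] ((Δ_[1])^[k] a) n ∈ Set.Icc (1 / W) (lam / W) := fun n => by
    have := h n; rwa [Function.iterate_succ_apply'] at this
  have h1 := mul_le_sub_of_forall_le_fwdDiff (fun n => (h' n).1) n m
  have h2 := sub_le_mul_of_forall_fwdDiff_le (fun n => (h' n).2) n m
  rw [Set.mem_Icc, div_div_eq_mul_div, div_div_eq_mul_div, one_mul]
  simp only [fwdDiff]
  refine ⟨le_trans (le_of_eq (by ring)) h1, h2.trans (le_of_eq (by ring))⟩

/-! ### Weighted power sums -/

/-- The profile `x^s - x^(s+1) / M`, equal to `(1 - x / M) x^s` for `x > 0`. -/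
noncomputable def weightProfile (s : ℝ) (M : ℕ) (x : ℝ) : ℝ := x ^ s - x ^ (s + 1) / M

lemma weightProfile_eq {s x : ℝ} (M : ℕ) (hx : 0 < x) :
    weightProfile s M x = (1 - x / M) * x ^ s := by
  rw [weightProfile, Real.rpow_add_one hx.ne']; ring

lemma intervalIntegrable_weightProfile {s : ℝ} (hs : -1 < s) (M : ℕ) (x y : ℝ) :
    IntervalIntegrable (weightProfile s M) MeasureTheory.volume x y :=
  (intervalIntegral.intervalIntegrable_rpow' hs).sub
    ((intervalIntegral.intervalIntegrable_rpow' (by linarith)).div_const _)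

lemma integral_weightProfile {s : ℝ} (hs : -1 < s) {M : ℕ} (hM : 0 < M) :
    ∫ x in (0 : ℝ)..M, weightProfile s M x = (M : ℝ) ^ (s + 1) / ((s + 1) * (s + 2)) := by
  have hM' : (0 : ℝ) < M := by exact_mod_cast hM
  have h1 : s + 1 ≠ 0 := by linarith
  have h2 : s + 2 ≠ 0 := by linarith
  simp only [weightProfile]
  rw [intervalIntegral.integral_sub (intervalIntegral.intervalIntegrable_rpow' hs)
    ((intervalIntegral.intervalIntegrable_rpow' (by linarith)).div_const _),
    intervalIntegral.integral_div, integral_rpow (Or.inl hs), integral_rpow (Or.inl (by linarith)),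
    Real.zero_rpow h1, Real.zero_rpow (by linarith : s + 1 + 1 ≠ 0),
    Real.rpow_add_one hM'.ne' (s + 1), show s + 1 + 1 = s + 2 by ring]
  field_simp
  ring

lemma sum_integral_weightProfile {s : ℝ} (hs : -1 < s) {M : ℕ} (hM : 0 < M) :
    ∑ n ∈ range M, ∫ x in (n : ℝ)..(n + 1 : ℕ), weightProfile s M x =
      (M : ℝ) ^ (s + 1) / ((s + 1) * (s + 2)) := by
  rw [intervalIntegral.sum_integral_adjacent_intervals
    fun n _ => intervalIntegrable_weightProfile hs M _ _, Nat.cast_zero,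
    integral_weightProfile hs hM]

/-- For `-1 < s ≤ 0` the profile decreases, and the sum is a lower Riemann sum. -/
lemma sum_weight_rpow_le_of_nonpos {s : ℝ} (hs : -1 < s) (hs0 : s ≤ 0) {M : ℕ} (hM : 0 < M) :
    ∑ m ∈ Ico 1 M, (1 - (m : ℝ) / M) * (m : ℝ) ^ s ≤
      (M : ℝ) ^ (s + 1) / ((s + 1) * (s + 2)) := by
  have hM' : (0 : ℝ) < M := by exact_mod_cast hM
  rw [← sum_integral_weightProfile hs hM]
  have e : ∑ m ∈ Ico 1 M, (1 - (m : ℝ) / M) * (m : ℝ) ^ s =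
      ∑ n ∈ range M, (1 - ((n + 1 : ℕ) : ℝ) / M) * ((n + 1 : ℕ) : ℝ) ^ s := by
    obtain ⟨K, rfl⟩ : ∃ K, M = K + 1 := ⟨M - 1, by omega⟩
    rw [sum_range_succ, div_self hM'.ne', sub_self, zero_mul, add_zero, sum_Ico_eq_sum_range]
    simp only [Nat.add_sub_cancel, add_comm 1]
  rw [e]
  refine sum_le_sum fun n hn => ?_
  have hn' : ((n + 1 : ℕ) : ℝ) ≤ M := by exact_mod_cast mem_range.1 hn
  have hnn : (n : ℝ) ≤ (n + 1 : ℕ) := by push_cast; linarith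
  have hc : ∫ _ in (n : ℝ)..(n + 1 : ℕ), (1 - ((n + 1 : ℕ) : ℝ) / M) * ((n + 1 : ℕ) : ℝ) ^ s =
      (1 - ((n + 1 : ℕ) : ℝ) / M) * ((n + 1 : ℕ) : ℝ) ^ s := by
    rw [intervalIntegral.integral_const]; push_cast; simp
  rw [← hc]
  refine intervalIntegral.integral_mono_on_of_le_Ioo hnn (by simp)
    (intervalIntegrable_weightProfile hs M _ _) fun x hx => ?_
  have hx0 : 0 < x := lt_of_le_of_lt (by positivity) hx.1
  rw [weightProfile_eq M hx0]
  refine mul_le_mul ?_ (Real.rpow_le_rpow_of_nonpos hx0 hx.2.le hs0) (by positivity) ?_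
  · have := div_le_div_of_nonneg_right hx.2.le hM'.le
    linarith
  · rw [sub_nonneg, div_le_one hM']; linarith [hx.2]

lemma concaveOn_weightProfile {s : ℝ} (hs0 : 0 ≤ s) (hs1 : s ≤ 1) (M : ℕ) :
    ConcaveOn ℝ (Set.Ici 0) (weightProfile s M) := by
  have h2 : ConvexOn ℝ (Set.Ici 0) fun x : ℝ => (1 / (M : ℝ)) • x ^ (s + 1) :=
    (convexOn_rpow (by linarith)).smul (by positivity)
  have := (Real.concaveOn_rpow hs0 hs1).sub h2
  refine this.congr fun x _ => ?_
  simp only [weightProfile, Pi.sub_apply, smul_eq_mul]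
  ring

/-- The trapezoid rule underestimates the integral of a concave function. -/
lemma trapezoid_le_integral_of_concaveOn {g : ℝ → ℝ} {c : ℝ} (hg : ConcaveOn ℝ (Set.Icc c (c + 1)) g)
    (hi : IntervalIntegrable g MeasureTheory.volume c (c + 1)) :
    (g c + g (c + 1)) / 2 ≤ ∫ x in c..(c + 1), g x := by
  have e : ∫ x in c..(c + 1), (g c + (x - c) * (g (c + 1) - g c)) = (g c + g (c + 1)) / 2 := by
    rw [intervalIntegral.integral_add (by simp)
      (Continuous.intervalIntegrable (by fun_prop) _ _), intervalIntegral.integral_mul_const,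
      intervalIntegral.integral_sub (by simp) (by simp), integral_id]
    simp only [intervalIntegral.integral_const, add_sub_cancel_left, smul_eq_mul]
    ring
  rw [← e]
  refine intervalIntegral.integral_mono_on (by linarith)
    (Continuous.intervalIntegrable (by fun_prop) _ _) hi fun x hx => ?_
  have := hg.2 (Set.left_mem_Icc.2 (by linarith : c ≤ c + 1))
    (Set.right_mem_Icc.2 (by linarith))
    (by linarith [hx.2] : (0 : ℝ) ≤ c + 1 - x) (by linarith [hx.1] : 0 ≤ x - c) (by ring)
  simp only [smul_eq_mul] at this
  rw [show (c + 1 - x) * c + (x - c) * (c + 1) = x by ring] at this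
  linarith

/-- For `0 < s ≤ 1` the profile is concave and vanishes at `0` and `M`, and the sum is its
trapezoid sum. -/
lemma sum_weight_rpow_le_of_pos {s : ℝ} (hs0 : 0 < s) (hs1 : s ≤ 1) {M : ℕ} (hM : 0 < M) :
    ∑ m ∈ Ico 1 M, (1 - (m : ℝ) / M) * (m : ℝ) ^ s ≤
      (M : ℝ) ^ (s + 1) / ((s + 1) * (s + 2)) := by
  have hM' : (0 : ℝ) < M := by exact_mod_cast hM
  rw [← sum_integral_weightProfile (by linarith) hM]
  set φ := weightProfile s M with hφ
  have h0 : φ (0 : ℕ) = 0 := by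
    simp [hφ, weightProfile, Real.zero_rpow hs0.ne', Real.zero_rpow (by linarith : s + 1 ≠ 0)]
  have h1 : φ M = 0 := by
    rw [hφ, weightProfile_eq M hM', div_self hM'.ne', sub_self, zero_mul]
  have e0 : ∑ m ∈ Ico 1 M, (1 - (m : ℝ) / M) * (m : ℝ) ^ s = ∑ n ∈ range M, φ n := by
    rw [range_eq_Ico, sum_eq_sum_Ico_succ_bot hM, h0, zero_add]
    refine sum_congr rfl fun m hm => ?_
    rw [hφ, weightProfile_eq M]
    exact_mod_cast (mem_Ico.1 hm).1
  have e1 : ∑ n ∈ range M, φ (n + 1 : ℕ) = ∑ n ∈ range M, φ n := by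
    have := sum_range_succ' (fun n : ℕ => φ n) M
    rw [sum_range_succ] at this
    rw [h0, h1] at this
    linarith
  have e2 : ∑ n ∈ range M, φ n = ∑ n ∈ range M, (φ n + φ (n + 1 : ℕ)) / 2 := by
    rw [← sum_div, sum_add_distrib, e1]; ring
  rw [e0, e2]
  refine sum_le_sum fun n _ => ?_
  push_cast
  refine trapezoid_le_integral_of_concaveOn ?_ (intervalIntegrable_weightProfile (by linarith) M _ _)
  refine (concaveOn_weightProfile hs0.le hs1 M).subset (fun x hx => ?_) (convex_Icc _ _)
  exact (Nat.cast_nonneg n).trans hx.1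

/-- The normalisation in which the weighted power sums enter the Weyl–van der Corput bound. -/
lemma two_mul_sum_weight_rpow_le {s : ℝ} (hs : -1 < s) (hs1 : s ≤ 1) {M : ℕ} (hM : 0 < M) :
    2 * ∑ m ∈ Ico 1 M, (1 - (m : ℝ) / M) * (m : ℝ) ^ s ≤
      M * (2 / ((s + 1) * (s + 2)) * (M : ℝ) ^ s) := by
  have hM' : (0 : ℝ) < M := by exact_mod_cast hM
  have : ∑ m ∈ Ico 1 M, (1 - (m : ℝ) / M) * (m : ℝ) ^ s ≤
      (M : ℝ) ^ (s + 1) / ((s + 1) * (s + 2)) := by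
    rcases le_or_gt s 0 with h | h
    · exact sum_weight_rpow_le_of_nonpos hs h hM
    · exact sum_weight_rpow_le_of_pos h hs1 hM
  rw [Real.rpow_add_one hM'.ne'] at this
  calc _ ≤ 2 * ((M : ℝ) ^ s * M / ((s + 1) * (s + 2))) := by linarith
    _ = _ := by ring

/-! ### One differencing step -/

/-- The Weyl–van der Corput inequality with `M = ⌈X⌉`, when the differenced sums are bounded by a
combination of powers of the shift. -/
lemma norm_seqSum_sq_le_of_differenced {ι : Type*} (t : Finset ι) (c s : ι → ℝ) (a : ℕ → ℝ)
    (L : ℕ) {X : ℝ} (hX : 0 < X) (hc : ∀ i ∈ t, 0 ≤ c i) (hs : ∀ i ∈ t, -1 < s i ∧ s i ≤ 1)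
    (h : ∀ m : ℕ, 0 < m → ‖seqSum (Δ_[m] a) (L - m)‖ ≤ ∑ i ∈ t, c i * (m : ℝ) ^ s i) :
    ‖seqSum a L‖ ^ 2 ≤ (L + X) *
      (L / X + ∑ i ∈ t, c i * (2 / ((s i + 1) * (s i + 2)) * (⌈X⌉₊ : ℝ) ^ s i)) := by
  have hM : 0 < ⌈X⌉₊ := Nat.ceil_pos.2 hX
  set M := ⌈X⌉₊ with hMdef
  have hM' : (0 : ℝ) < M := by exact_mod_cast hM
  have hM1 : (1 : ℝ) ≤ M := by exact_mod_cast hM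
  have hXM : X ≤ M := Nat.le_ceil X
  have hMX : (M : ℝ) < X + 1 := Nat.ceil_lt_add_one hX.le
  set Q := ∑ i ∈ t, c i * (2 / ((s i + 1) * (s i + 2)) * (M : ℝ) ^ s i) with hQ
  have hQ0 : 0 ≤ Q := sum_nonneg fun i hi => by
    have := hs i hi
    have h1 : 0 < s i + 1 := by linarith
    have h2 : 0 < s i + 2 := by linarith
    have := hc i hi
    positivity
  have h1 : 2 * ∑ m ∈ Ico 1 M, (1 - (m : ℝ) / M) * ‖seqSum (Δ_[m] a) (L - m)‖ ≤ M * Q := by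
    have e : 2 * ∑ m ∈ Ico 1 M, (1 - (m : ℝ) / M) * ∑ i ∈ t, c i * (m : ℝ) ^ s i =
        ∑ i ∈ t, c i * (2 * ∑ m ∈ Ico 1 M, (1 - (m : ℝ) / M) * (m : ℝ) ^ s i) := by
      simp only [mul_sum]
      rw [sum_comm]
      exact sum_congr rfl fun i _ => sum_congr rfl fun m _ => by ring
    calc _ ≤ 2 * ∑ m ∈ Ico 1 M, (1 - (m : ℝ) / M) * ∑ i ∈ t, c i * (m : ℝ) ^ s i := by
          refine mul_le_mul_of_nonneg_left (sum_le_sum fun m hm => ?_) (by norm_num)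
          rw [mem_Ico] at hm
          refine mul_le_mul_of_nonneg_left (h m (by omega)) ?_
          rw [sub_nonneg, div_le_one hM']
          exact_mod_cast hm.2.le
      _ = _ := e
      _ ≤ ∑ i ∈ t, c i * (M * (2 / ((s i + 1) * (s i + 2)) * (M : ℝ) ^ s i)) :=
          sum_le_sum fun i hi => mul_le_mul_of_nonneg_left
            (two_mul_sum_weight_rpow_le (hs i hi).1 (hs i hi).2 hM) (hc i hi)
      _ = M * Q := by
          rw [hQ, mul_sum]
          exact sum_congr rfl fun i _ => by ring
  have hL : (0 : ℝ) ≤ L := Nat.cast_nonneg L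
  have h2 := norm_seqSum_sq_le a L hM
  calc _ ≤ _ := h2
    _ ≤ (L + M - 1) / M * (L + M * Q) := by
        refine mul_le_mul_of_nonneg_left (by linarith) ?_
        exact div_nonneg (by linarith) hM'.le
    _ = (L + M - 1) * (L / M + Q) := by field_simp
    _ ≤ (L + X) * (L / X + Q) := by
        refine mul_le_mul (by linarith) ?_ (by positivity) (by positivity)
        have := div_le_div_of_nonneg_left hL hX hXM
        linarith

/-! ### The third-difference test -/

lemma alpha3Tilde_pos {η lam : ℝ} (hη : 0 < η) (hlam : 1 ≤ lam) : 0 < alpha3Tilde η lam := by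
  have : 0 < lam := by linarith
  rw [alpha3Tilde]; positivity

lemma two_mul_add_le_alpha3Tilde {η lam : ℝ} (hη : 0 < η) (hlam : 1 ≤ lam) :
    2 * η + 2 ≤ alpha3Tilde η lam := by
  have h0 : 0 < lam := by linarith
  have : 0 ≤ 1 / η + 32 * lam / (15 * √Real.pi) * √(η + 1) := by positivity
  rw [alpha3Tilde]
  nlinarith

lemma four_le_beta3Tilde (η : ℝ) : 4 ≤ beta3Tilde η := by
  have : 0 ≤ 64 / (3 * √Real.pi * √η) := by positivity
  rw [beta3Tilde]; linarith

/-- **Third-difference test** for third differences of size `w ^ (-6)`, from one Weyl–van der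
Corput step with about `η w ^ 2` shifts and the second-difference test. -/
lemma norm_seqSum_sq_le_of_third_fwdDiff {a : ℕ → ℝ} {w lam η : ℝ} (hw : 1 ≤ w) (hlam : 1 ≤ lam)
    (hη : 0 < η) (h : ∀ n, (Δ_[1])^[3] a n ∈ Set.Icc (1 / w ^ 6) (lam / w ^ 6)) (L : ℕ) :
    ‖seqSum a L‖ ^ 2 ≤
      (L / w ^ 2 + η) * (alpha3Tilde η lam * L + beta3Tilde η * w ^ 4) := by
  have hw0 : 0 < w := by linarith
  have hl0 : 0 < lam := by linarith
  have hL : (0 : ℝ) ≤ L := Nat.cast_nonneg L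
  set p := √Real.pi with hp
  have hp0 : 0 < p := Real.sqrt_pos.2 Real.pi_pos
  have hX : 0 < η * w ^ 2 := by positivity
  have key := norm_seqSum_sq_le_of_differenced (univ : Finset (Fin 4))
    ![4 * lam * L / (w ^ 3 * p), lam * L / w ^ 6, 8 * w ^ 3 / p, 2] ![1 / 2, 1, -(1 / 2), 0]
    a L hX (by
      intro i _
      fin_cases i
      · change 0 ≤ 4 * lam * L / (w ^ 3 * p); positivity
      · change 0 ≤ lam * L / w ^ 6; positivity
      · change 0 ≤ 8 * w ^ 3 / p; positivity
      · change (0 : ℝ) ≤ 2; norm_num)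
    (by intro i _; fin_cases i <;> norm_num) (by
      intro m hm
      have hm0 : (0 : ℝ) < m := by exact_mod_cast hm
      have h2 := norm_seqSum_le_of_second_fwdDiff (W := w ^ 6 / m) (by positivity) hlam
        (fwdDiff_iter_fwdDiff_mem (k := 2) h m) (L - m)
      have hLm : ((L - m : ℕ) : ℝ) ≤ L := by exact_mod_cast Nat.sub_le L m
      have e6 : √(w ^ 6 / m) = w ^ 3 / √m := by
        rw [Real.sqrt_div (by positivity), show w ^ 6 = (w ^ 3) ^ 2 by ring,
          Real.sqrt_sq (by positivity)]
      have hq0 : 0 < √(m : ℝ) := Real.sqrt_pos.2 hm0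
      have hq2 : √(m : ℝ) ^ 2 = m := Real.sq_sqrt hm0.le
      rw [e6] at h2
      simp only [Fin.sum_univ_four, Matrix.cons_val]
      rw [Real.rpow_neg hm0.le, ← Real.sqrt_eq_rpow, Real.rpow_one, Real.rpow_zero]
      refine h2.trans ?_
      calc _ ≤ (lam * L / (w ^ 6 / m) + 2) * (4 * (w ^ 3 / √m / p) + 1) := by gcongr
        _ = _ := by
          rw [← hq2, Real.sqrt_sq hq0.le]
          field_simp
          ring)
  set M : ℝ := (⌈η * w ^ 2⌉₊ : ℝ) with hM
  have hXM : η * w ^ 2 ≤ M := Nat.le_ceil _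
  have hMX : M < η * w ^ 2 + 1 := Nat.ceil_lt_add_one hX.le
  have hM0 : 0 < M := hX.trans_le hXM
  simp only [Fin.sum_univ_four, Matrix.cons_val] at key
  rw [Real.rpow_neg hM0.le, ← Real.sqrt_eq_rpow, Real.rpow_one, Real.rpow_zero] at key
  refine key.trans ?_
  have hw2 : 1 ≤ w ^ 2 := one_le_pow₀ hw
  have hM1 : M ≤ w ^ 2 * (η + 1) := by nlinarith
  have hs1 : √M ≤ w * √(η + 1) := by
    have := Real.sqrt_le_sqrt hM1
    rwa [Real.sqrt_mul (by positivity), Real.sqrt_sq hw0.le] at this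
  have hs2 : w * √η ≤ √M := by
    have := Real.sqrt_le_sqrt hXM
    rwa [mul_comm, Real.sqrt_mul (by positivity), Real.sqrt_sq hw0.le] at this
  have hη2 : 0 < √η := Real.sqrt_pos.2 hη
  have t1 : 4 * lam * L / (w ^ 3 * p) * (2 / ((1 / 2 + 1) * (1 / 2 + 2)) * √M) ≤
      32 * lam / (15 * p) * √(η + 1) * L / w ^ 2 := by
    calc _ ≤ 4 * lam * L / (w ^ 3 * p) * (2 / ((1 / 2 + 1) * (1 / 2 + 2)) * (w * √(η + 1))) := by
          gcongr
      _ = _ := by field_simp; ring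
  have t2 : lam * L / w ^ 6 * (2 / ((1 + 1) * (1 + 2)) * M) ≤
      (2 * lam * η + 2 * lam) * L / w ^ 2 := by
    calc _ ≤ lam * L / w ^ 6 * (2 / ((1 + 1) * (1 + 2)) * (w ^ 2 * (η + 1))) := by gcongr
      _ = lam * (η + 1) / 3 * L / (w ^ 2 * w ^ 2) := by field_simp; ring
      _ ≤ (2 * lam * η + 2 * lam) * L / (w ^ 2 * 1) := by
          gcongr
          have : 0 < lam * (η + 1) := by positivity
          linarith
      _ = _ := by rw [mul_one]
  have t3 : 8 * w ^ 3 / p * (2 / ((-(1 / 2) + 1) * (-(1 / 2) + 2)) * (√M)⁻¹) ≤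
      64 / (3 * p * √η) * w ^ 4 / w ^ 2 := by
    calc _ ≤ 8 * w ^ 3 / p * (2 / ((-(1 / 2) + 1) * (-(1 / 2) + 2)) * (w * √η)⁻¹) := by
          have : (0 : ℝ) ≤ 2 / ((-(1 / 2) + 1) * (-(1 / 2) + 2)) := by norm_num
          gcongr
      _ = _ := by field_simp; norm_num
  have t4 : (2 : ℝ) * (2 / ((0 + 1) * (0 + 2)) * 1) ≤ 4 * w ^ 4 / w ^ 2 := by
    rw [show 4 * w ^ 4 / w ^ 2 = 4 * w ^ 2 by field_simp]
    linarith
  calc _ ≤ (L + η * w ^ 2) * (L / (η * w ^ 2) +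
        (32 * lam / (15 * p) * √(η + 1) * L / w ^ 2 + (2 * lam * η + 2 * lam) * L / w ^ 2 +
          64 / (3 * p * √η) * w ^ 4 / w ^ 2 + 4 * w ^ 4 / w ^ 2)) := by
        refine mul_le_mul_of_nonneg_left ?_ (by positivity)
        linarith
    _ = _ := by
        rw [alpha3Tilde, beta3Tilde, ← hp]
        field_simp
        ring

/-- Taking square roots in a product of two binomials costs only half of the last cross term as
soon as `3 q ≤ 4 p`. -/
lemma le_of_sq_le_mul_add {x p q r s : ℝ} (hp : 0 ≤ p) (hq : 0 ≤ q) (hr : 0 ≤ r) (hs : 0 ≤ s)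
    (hpq : 3 * q ≤ 4 * p) (h : x ^ 2 ≤ (p ^ 2 + q ^ 2) * (r ^ 2 + s ^ 2)) :
    x ≤ p * r + p * s + q * r + q * s / 2 := by
  refine le_of_sq_le_sq (h.trans ?_) (by positivity)
  have h1 : 0 ≤ q * s ^ 2 * (4 * p - 3 * q) := mul_nonneg (by positivity) (by linarith)
  have h2 : 0 ≤ p ^ 2 * r * s := by positivity
  have h3 : 0 ≤ p * q * r ^ 2 := by positivity
  have h4 : 0 ≤ p * q * r * s := by positivity
  have h5 : 0 ≤ q ^ 2 * r * s := by positivity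
  linarith

lemma alpha3Tilde_le {η η' lam : ℝ} (hη' : 0 < η') (h : η' ≤ η) (hlam : 1 ≤ lam) :
    alpha3Tilde η' lam ≤ 1 / η' + alpha3Tilde η lam := by
  have hl : 0 < lam := by linarith
  have h0 : 0 < 1 / η := one_div_pos.2 (hη'.trans_le h)
  have h1 : 32 * lam / (15 * √Real.pi) * √(η' + 1) ≤ 32 * lam / (15 * √Real.pi) * √(η + 1) := by
    gcongr
  have h2 : 2 * lam * η' ≤ 2 * lam * η := by gcongr
  simp only [alpha3Tilde]
  linarith

/-- When `4 p < 3 q` and `q` is not small, the parameter `p ^ 2` in place of `q ^ 2` gives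
at most the bound with the halved cross term. -/
lemma le_of_sq_le_smaller_parameter {x p q r s w lam L : ℝ} (hp : 0 < p) (hq : 0 < q)
    (hr : 0 ≤ r) (hs : 0 ≤ s) (hpq : 4 * p < 3 * q) (hq2 : 2 < q ^ 2) (hL : 0 ≤ L)
    (hlam : 1 ≤ lam) (hr2 : r ^ 2 = alpha3Tilde (q ^ 2) lam * L)
    (hs2 : s ^ 2 = beta3Tilde (q ^ 2) * w ^ 4)
    (h : x ^ 2 ≤ (p ^ 2 + p ^ 2) *
      (alpha3Tilde (p ^ 2) lam * L + beta3Tilde (p ^ 2) * w ^ 4)) :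
    x ≤ p * r + p * s + q * r + q * s / 2 := by
  have hpq' : p ≤ q := by linarith
  have hpη : p ^ 2 ≤ q ^ 2 := by gcongr
  have hα2 := two_mul_add_le_alpha3Tilde (by positivity : 0 < q ^ 2) hlam
  have h1 := alpha3Tilde_le (by positivity : 0 < p ^ 2) hpη hlam
  set α := alpha3Tilde (q ^ 2) lam with hα
  set c := 64 / (3 * √Real.pi) with hc
  have hc0 : 0 < c := by positivity
  have hβc : beta3Tilde (q ^ 2) = c / q + 4 := by rw [beta3Tilde, hc, Real.sqrt_sq hq.le]; field_simp
  have hβc' : beta3Tilde (p ^ 2) = c / p + 4 := by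
    rw [beta3Tilde, hc, Real.sqrt_sq hp.le]; field_simp
  refine le_of_sq_le_sq (h.trans ?_) (by positivity)
  have hαpart : (p ^ 2 + p ^ 2) * (alpha3Tilde (p ^ 2) lam * L) ≤ (p ^ 2 + q ^ 2) * r ^ 2 := by
    have h2 : (p ^ 2 + p ^ 2) * (alpha3Tilde (p ^ 2) lam * L) ≤
        (p ^ 2 + p ^ 2) * ((1 / p ^ 2 + α) * L) := by gcongr
    have h3 : (p ^ 2 + p ^ 2) * ((1 / p ^ 2 + α) * L) = 2 * L + 2 * p ^ 2 * α * L := by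
      field_simp
      ring
    have h4 : 2 ≤ (q ^ 2 - p ^ 2) * α := by
      have h5 : p ^ 2 ≤ (3 / 4 * q) ^ 2 := by gcongr; linarith
      have h7 : (7 / 8 : ℝ) * 6 ≤ (q ^ 2 - p ^ 2) * α :=
        mul_le_mul (by linarith) (by linarith) (by norm_num) (by linarith)
      linarith
    have h6 : 2 * L ≤ (q ^ 2 - p ^ 2) * α * L := by gcongr
    rw [hr2]
    linarith
  have hβpart : (p ^ 2 + p ^ 2) * (beta3Tilde (p ^ 2) * w ^ 4) ≤ (p + q / 2) ^ 2 * s ^ 2 := by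
    rw [hs2, hβc, hβc', ← mul_assoc, ← mul_assoc]
    refine mul_le_mul_of_nonneg_right ?_ (by positivity)
    have h2 : (p ^ 2 + p ^ 2) * (c / p + 4) = 2 * p * q * (c / q) + 8 * p ^ 2 := by
      field_simp; ring
    have h3 : 2 * p * q ≤ (p + q / 2) ^ 2 := by linarith [sq_nonneg (p - q / 2)]
    have h4 : 8 * p ^ 2 ≤ (p + q / 2) ^ 2 * 4 := by
      have : (p + p / 2) ^ 2 ≤ (p + q / 2) ^ 2 := by gcongr
      linarith [sq_nonneg p]
    have h5 : 2 * p * q * (c / q) ≤ (p + q / 2) ^ 2 * (c / q) := by gcongr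
    linarith
  have hcross : 0 ≤ 2 * (p * r) * (p * s) + 2 * (p * r) * (q * r) + (p * r) * (q * s) +
      2 * (p * s) * (q * r) + (q * r) * (q * s) := by positivity
  linarith

/-- The third-difference test in the form of a bound for the sum itself. The last of the four terms
carries the factor `1 / 2`, half of what the subadditivity of the square root gives. For sums with
`L` small against `η w ^ 2`, where subadditivity is wasteful in that term, the trivial bound or the
test with the smaller parameter `L / w ^ 2` in place of `η` is used. -/
lemma norm_seqSum_le_of_third_fwdDiff {a : ℕ → ℝ} {w lam η : ℝ} (hw : 0 < w) (hlam : 1 ≤ lam)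
    (hη : 0 < η) (h : ∀ n, (Δ_[1])^[3] a n ∈ Set.Icc (1 / w ^ 6) (lam / w ^ 6)) (L : ℕ) :
    ‖seqSum a L‖ ≤ √(alpha3Tilde η lam) * L / w + √(beta3Tilde η) * √L * w +
      √(η * alpha3Tilde η lam) * √L + √(beta3Tilde η * η) * w ^ 2 / 2 := by
  have hα0 := alpha3Tilde_pos hη hlam
  have hα2 := two_mul_add_le_alpha3Tilde hη hlam
  have hβ4 := four_le_beta3Tilde η
  have hβ0 : 0 < beta3Tilde η := by linarith
  have hL : (0 : ℝ) ≤ L := Nat.cast_nonneg L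
  set α := alpha3Tilde η lam with hα
  set β := beta3Tilde η with hβ
  have htriv := norm_seqSum_le a L
  set p := √(L : ℝ) / w with hp
  set q := √η with hq
  set r := √α * √L with hr
  set s := √β * w ^ 2 with hs
  have hLL : √(L : ℝ) ^ 2 = L := Real.sq_sqrt hL
  have hp0 : 0 ≤ p := by positivity
  have hq0 : 0 < q := Real.sqrt_pos.2 hη
  have hr0 : 0 ≤ r := by positivity
  have hs0 : 0 ≤ s := by positivity
  have hp2 : p ^ 2 = L / w ^ 2 := by rw [hp, div_pow, hLL]
  have hq2 : q ^ 2 = η := Real.sq_sqrt hη.le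
  have hr2 : r ^ 2 = α * L := by rw [hr, mul_pow, hLL, Real.sq_sqrt hα0.le]
  have hs2 : s ^ 2 = β * w ^ 4 := by rw [hs, mul_pow, Real.sq_sqrt hβ0.le]; ring
  have e : √α * L / w + √β * √L * w + √(η * α) * √L + √(β * η) * w ^ 2 / 2 =
      p * r + p * s + q * r + q * s / 2 := by
    rw [Real.sqrt_mul hη.le, Real.sqrt_mul hβ0.le, hp, hr, hs, hq]
    nth_rewrite 1 [← hLL]
    field_simp
  rw [e]
  have hps : 0 ≤ p * s := by positivity
  have hqr : 0 ≤ q * r := by positivity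
  have hqs : 0 ≤ q * s := by positivity
  have hpr : 0 ≤ p * r := by positivity
  rcases lt_or_ge w 1 with hw1 | hw1
  · -- For `w < 1` the first term alone exceeds the trivial bound.
    have h1 : 1 ≤ √α := Real.one_le_sqrt.2 (by linarith)
    have h2 : p * r = √α * L / w := by rw [hp, hr, ← hLL, Real.sqrt_sq (by positivity)]; ring
    have h3 : (L : ℝ) ≤ p * r := by
      rw [h2, le_div_iff₀ hw]
      nlinarith
    linarith
  have htest := norm_seqSum_sq_le_of_third_fwdDiff hw1 hlam hη h L
  rw [← hp2, ← hα, ← hβ, ← hr2, ← hs2, ← hq2] at htest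
  rcases le_or_gt (3 * q) (4 * p) with hpq | hpq
  · exact le_of_sq_le_mul_add hp0 hq0.le hr0 hs0 hpq htest
  have hLp : (L : ℝ) = p ^ 2 * w ^ 2 := by rw [hp2]; field_simp
  rcases le_or_gt η 2 with hη2 | hη2
  · -- Here `L ≤ (9/16) η w ^ 2 ≤ √η w ^ 2 ≤ q s / 2`.
    have h1 : 2 * w ^ 2 ≤ s := by
      have : 2 ≤ √β := Real.le_sqrt_of_sq_le (by linarith)
      rw [hs]; gcongr
    have h2 : p ^ 2 ≤ q := by
      have : q ≤ 16 / 9 := Real.sqrt_le_iff.2 ⟨by norm_num, by linarith⟩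
      nlinarith
    have h3 : q * (2 * w ^ 2) ≤ q * s := by gcongr
    have h4 : p ^ 2 * w ^ 2 ≤ q * w ^ 2 := by gcongr
    linarith
  rcases hp0.eq_or_lt with hp00 | hp00
  · rw [← hp00] at hLp
    have : (L : ℝ) = 0 := by rw [hLp]; ring
    rw [this] at htriv
    linarith
  -- The remaining case: the test with parameter `p ^ 2 = L / w ^ 2`.
  have htest' := norm_seqSum_sq_le_of_third_fwdDiff hw1 hlam (by positivity : 0 < p ^ 2) h L
  rw [← hp2] at htest'
  rw [← hq2] at hη2
  exact le_of_sq_le_smaller_parameter hp00 hq0 hr0 hs0 hpq hη2 hL hlam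
    (by rw [hq2, hr2]) (by rw [hq2, hs2]) htest'

/-! ### The fourth-difference test -/

/-- **Fourth-difference test** for fourth differences of size `v ^ (-42)`, from one Weyl–van der
Corput step with about `η₄ v ^ 6` shifts and the third-difference test. -/
lemma norm_seqSum_sq_le_of_fourth_fwdDiff {a : ℕ → ℝ} {v lam η₃ η₄ : ℝ} (hv : 0 < v)
    (hlam : 1 ≤ lam) (hη₃ : 0 < η₃) (hη₄ : 0 < η₄)
    (h : ∀ n, (Δ_[1])^[4] a n ∈ Set.Icc (1 / v ^ 42) (lam / v ^ 42)) (L : ℕ) :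
    ‖seqSum a L‖ ^ 2 ≤ (L / v ^ 6 + η₄) *
      ((1 / η₄ + 72 / 91 * √(alpha3Tilde η₃ lam) * (η₄ + 1 / v ^ 6) ^ (1 / 6 : ℝ)) * L +
        (72 / 55 * √(beta3Tilde η₃) * η₄ ^ (-(1 / 6) : ℝ) +
          √(η₃ * alpha3Tilde η₃ lam) * (1 / v ^ 6)) * √L * v ^ 12 +
        18 / 20 * √(beta3Tilde η₃ * η₃) * η₄ ^ (-(1 / 3) : ℝ) * v ^ 18) := by
  have hL : (0 : ℝ) ≤ L := Nat.cast_nonneg L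
  set A := √(alpha3Tilde η₃ lam) with hA
  set B := √(beta3Tilde η₃) with hB
  set C := √(η₃ * alpha3Tilde η₃ lam) with hC
  set D := √(beta3Tilde η₃ * η₃) with hD
  have hX : 0 < η₄ * v ^ 6 := by positivity
  have key := norm_seqSum_sq_le_of_differenced (univ : Finset (Fin 4))
    ![A * L / v ^ 7, B * √L * v ^ 7, C * √L, D * v ^ 14 / 2] ![1 / 6, -(1 / 6), 0, -(1 / 3)]
    a L hX (by
      intro i _
      fin_cases i
      · change 0 ≤ A * L / v ^ 7; positivity
      · change 0 ≤ B * √L * v ^ 7; positivity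
      · change 0 ≤ C * √L; positivity
      · change 0 ≤ D * v ^ 14 / 2; positivity)
    (by intro i _; fin_cases i <;> norm_num) (by
      intro m hm
      have hm0 : (0 : ℝ) < m := by exact_mod_cast hm
      set u := (m : ℝ) ^ (1 / 6 : ℝ) with hu
      have hu0 : 0 < u := by positivity
      have hu6 : u ^ 6 = m := by rw [hu, ← Real.rpow_mul_natCast hm0.le]; norm_num
      have hu3 : (m : ℝ) ^ (1 / 3 : ℝ) = u ^ 2 := by
        rw [hu, ← Real.rpow_mul_natCast hm0.le]; norm_num
      have e6 : v ^ 42 / m = (v ^ 7 / u) ^ 6 := by rw [← hu6, div_pow]; ring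
      have h3 : ∀ n, (Δ_[1])^[3] (Δ_[m] a) n ∈
          Set.Icc (1 / (v ^ 7 / u) ^ 6) (lam / (v ^ 7 / u) ^ 6) := by
        rw [← e6]; exact fwdDiff_iter_fwdDiff_mem (k := 3) h m
      have h2 := norm_seqSum_le_of_third_fwdDiff (by positivity) hlam hη₃ h3 (L - m)
      rw [← hA, ← hB, ← hC, ← hD] at h2
      have hLm : ((L - m : ℕ) : ℝ) ≤ L := by exact_mod_cast Nat.sub_le L m
      simp only [Fin.sum_univ_four, Matrix.cons_val]
      rw [Real.rpow_neg hm0.le, Real.rpow_neg hm0.le, ← hu, hu3, Real.rpow_zero]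
      refine h2.trans ?_
      calc _ ≤ A * L / (v ^ 7 / u) + B * √L * (v ^ 7 / u) + C * √L +
            D * (v ^ 7 / u) ^ 2 / 2 := by gcongr
        _ = _ := by field_simp)
  set M : ℝ := (⌈η₄ * v ^ 6⌉₊ : ℝ) with hM
  have hXM : η₄ * v ^ 6 ≤ M := Nat.le_ceil _
  have hMX : M ≤ v ^ 6 * (η₄ + 1 / v ^ 6) := by
    have : v ^ 6 * (η₄ + 1 / v ^ 6) = η₄ * v ^ 6 + 1 := by field_simp
    rw [this]; exact (Nat.ceil_lt_add_one hX.le).le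
  have hM0 : 0 < M := hX.trans_le hXM
  have hv6 : (v ^ 6 : ℝ) ^ (1 / 6 : ℝ) = v := by
    rw [← Real.rpow_natCast_mul hv.le]; norm_num
  have hv3 : (v ^ 6 : ℝ) ^ (1 / 3 : ℝ) = v ^ 2 := by
    rw [← Real.rpow_natCast_mul hv.le]; norm_num
  have s1 : M ^ (1 / 6 : ℝ) ≤ v * (η₄ + 1 / v ^ 6) ^ (1 / 6 : ℝ) := by
    have := Real.rpow_le_rpow hM0.le hMX (by norm_num : (0 : ℝ) ≤ 1 / 6)
    rwa [Real.mul_rpow (by positivity) (by positivity), hv6] at this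
  have s2 : M ^ (-(1 / 6) : ℝ) ≤ η₄ ^ (-(1 / 6) : ℝ) / v := by
    have := Real.rpow_le_rpow_of_nonpos hX hXM (by norm_num : (-(1 / 6) : ℝ) ≤ 0)
    rwa [Real.mul_rpow hη₄.le (by positivity), Real.rpow_neg (by positivity : 0 ≤ v ^ 6), hv6,
      ← div_eq_mul_inv] at this
  have s3 : M ^ (-(1 / 3) : ℝ) ≤ η₄ ^ (-(1 / 3) : ℝ) / v ^ 2 := by
    have := Real.rpow_le_rpow_of_nonpos hX hXM (by norm_num : (-(1 / 3) : ℝ) ≤ 0)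
    rwa [Real.mul_rpow hη₄.le (by positivity), Real.rpow_neg (by positivity : 0 ≤ v ^ 6), hv3,
      ← div_eq_mul_inv] at this
  simp only [Fin.sum_univ_four, Matrix.cons_val] at key
  rw [Real.rpow_zero] at key
  have c1 : (2 : ℝ) / ((1 / 6 + 1) * (1 / 6 + 2)) = 72 / 91 := by norm_num
  have c2 : (2 : ℝ) / ((-(1 / 6) + 1) * (-(1 / 6) + 2)) = 72 / 55 := by norm_num
  have c3 : (2 : ℝ) / ((0 + 1) * (0 + 2)) = 1 := by norm_num
  have c4 : (2 : ℝ) / ((-(1 / 3) + 1) * (-(1 / 3) + 2)) = 9 / 5 := by norm_num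
  rw [c1, c2, c3, c4] at key
  set E := (η₄ + 1 / v ^ 6) ^ (1 / 6 : ℝ) with hE
  set F := η₄ ^ (-(1 / 6) : ℝ) with hF
  set G := η₄ ^ (-(1 / 3) : ℝ) with hG
  calc _ ≤ _ := key
    _ ≤ (L + η₄ * v ^ 6) * (L / (η₄ * v ^ 6) + (A * L / v ^ 7 * (72 / 91 * (v * E)) +
          B * √L * v ^ 7 * (72 / 55 * (F / v)) + C * √L * (1 * 1) +
          D * v ^ 14 / 2 * (9 / 5 * (G / v ^ 2)))) := by
        gcongr
    _ = _ := by
        field_simp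
        ring

/-! ### From derivatives to differences -/

/-- A finite sequence whose `k`-th differences satisfy `P` extends to an infinite one. -/
lemma exists_extension_fwdDiff_iter {P : ℝ → Prop} {d : ℝ} (hd : P d) (k : ℕ) :
    ∀ (a : ℕ → ℝ) (L : ℕ), (∀ n, n + k < L → P ((Δ_[1])^[k] a n)) →
      ∃ b : ℕ → ℝ, (∀ n < L, b n = a n) ∧ ∀ n, P ((Δ_[1])^[k] b n) := by
  induction k with
  | zero =>
    intro a L h
    refine ⟨fun n => if n < L then a n else d, fun n hn => if_pos hn, fun n => ?_⟩
    simp only [Function.iterate_zero, id_eq]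
    split_ifs with hn
    · exact h n hn
    · exact hd
  | succ k ih =>
    intro a L h
    obtain ⟨b, hb, hP⟩ := ih (Δ_[1] a) (L - 1) fun n hn => h n (by omega)
    refine ⟨fun n => a 0 + ∑ i ∈ range n, b i, fun n hn => ?_, fun n => ?_⟩
    · have : ∑ i ∈ range n, b i = ∑ i ∈ range n, (a (i + 1) - a i) :=
        sum_congr rfl fun i hi => hb i (by have := mem_range.1 hi; omega)
      change a 0 + ∑ i ∈ range n, b i = a n
      rw [this, sum_range_sub]; ring
    · have : Δ_[1] (fun n => a 0 + ∑ i ∈ range n, b i) = b := by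
        funext n
        simp only [fwdDiff, sum_range_succ]; ring
      rw [Function.iterate_succ_apply, this]
      exact hP n

/-- Mean value theorem for iterated forward differences: if `F (i + 1)` is the derivative of `F i`
for `i < k`, the values of the `k`-th difference of `F 0` obey the bounds of `F k`. -/
lemma fwdDiff_iter_mem_of_hasDerivWithinAt {A l u : ℝ} (k : ℕ) :
    ∀ (F : ℕ → ℝ → ℝ) (B : ℝ),
      (∀ i < k, ∀ x ∈ Set.Icc A B, HasDerivWithinAt (F i) (F (i + 1) x) (Set.Icc A B) x) →
      (∀ x ∈ Set.Icc A B, F k x ∈ Set.Icc l u) →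
      ∀ x, A ≤ x → x + k ≤ B → (Δ_[(1 : ℝ)])^[k] (F 0) x ∈ Set.Icc l u := by
  induction k with
  | zero =>
    intro F B _ h x hA hB
    exact h x ⟨hA, by simpa using hB⟩
  | succ k ih =>
    intro F B hF h x hA hB
    rw [Function.iterate_succ_apply]
    push_cast at hB
    refine ih (fun i => Δ_[(1 : ℝ)] (F i)) (B - 1) (fun i hi y hy => ?_) (fun y hy => ?_) x hA
      (by linarith)
    · have hmaps : Set.MapsTo (fun z : ℝ => z + 1) (Set.Icc A (B - 1)) (Set.Icc A B) :=
        fun z hz => ⟨by linarith [hz.1], by linarith [hz.2]⟩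
      have h1 := (hF i (by omega) (y + 1) (hmaps hy)).comp y
        ((hasDerivAt_id y).add_const 1).hasDerivWithinAt hmaps
      have h2 := (hF i (by omega) y ⟨hy.1, by linarith [hy.2]⟩).mono
        (Set.Icc_subset_Icc_right (by linarith : B - 1 ≤ B))
      rw [mul_one] at h1
      exact h1.sub h2
    · have hsub : Set.Icc y (y + 1) ⊆ Set.Icc A B :=
        Set.Icc_subset_Icc hy.1 (by linarith [hy.2])
      obtain ⟨ξ, hξ, he⟩ := exists_hasDerivAt_eq_slope (F k) (F (k + 1))
        (by linarith : y < y + 1)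
        (fun z hz => ((hF k (by omega) z (hsub hz)).continuousWithinAt).mono hsub)
        (fun z hz => (hF k (by omega) z (hsub (Set.Ioo_subset_Icc_self hz))).hasDerivAt
          (Filter.mem_of_superset (Icc_mem_nhds hz.1 hz.2) hsub))
      rw [add_sub_cancel_left, div_one] at he
      have := h ξ (hsub (Set.Ioo_subset_Icc_self hξ))
      rw [he] at this
      exact this

lemma fwdDiff_iter_sample (c : ℝ) (k : ℕ) : ∀ f : ℝ → ℝ,
    (Δ_[1])^[k] (fun n : ℕ => f (c + n)) = fun n : ℕ => (Δ_[(1 : ℝ)])^[k] f (c + n) := by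
  induction k with
  | zero => intro f; rfl
  | succ k ih =>
    intro f
    rw [Function.iterate_succ_apply, Function.iterate_succ_apply, ← ih]
    congr 1
    funext n
    simp only [fwdDiff]
    push_cast
    rw [add_assoc]

lemma expSum_eq_seqSum (f : ℝ → ℝ) (N : ℤ) (L : ℕ) :
    expSum f N L = seqSum (fun n => f ((N : ℝ) + 1 + n)) L := by
  rw [expSum, seqSum]
  refine sum_nbij' (fun n => (n - (N + 1)).toNat) (fun n => N + 1 + (n : ℤ)) ?_ ?_ ?_ ?_ ?_
  · intro n hn; simp only [mem_Icc, mem_range] at hn ⊢; omega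
  · intro n hn; simp only [mem_Icc, mem_range] at hn ⊢; omega
  · intro n hn; simp only [mem_Icc] at hn; omega
  · intro n _; omega
  · intro n hn
    simp only [mem_Icc] at hn
    rw [expPhase]
    congr 4
    have : ((n - (N + 1)).toNat : ℝ) = ((n - (N + 1) : ℤ) : ℝ) := by
      rw [← Int.cast_natCast, Int.toNat_of_nonneg (by omega)]
    rw [this]; push_cast; ring

/-- A continuous function on an interval whose absolute value is bounded below has one sign. -/
lemma forall_mem_Icc_or_neg_mem_Icc {g : ℝ → ℝ} {A B l u : ℝ} (hl : 0 < l)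
    (hg : ContinuousOn g (Set.Icc A B)) (h : ∀ x ∈ Set.Icc A B, l ≤ |g x| ∧ |g x| ≤ u) :
    (∀ x ∈ Set.Icc A B, g x ∈ Set.Icc l u) ∨ ∀ x ∈ Set.Icc A B, -g x ∈ Set.Icc l u := by
  have hsign : (∀ x ∈ Set.Icc A B, 0 ≤ g x) ∨ ∀ x ∈ Set.Icc A B, g x ≤ 0 := by
    by_contra! hcon
    obtain ⟨⟨x, hx, hx0⟩, y, hy, hy0⟩ := hcon
    obtain ⟨z, hz, hz0⟩ := isPreconnected_Icc.intermediate_value hx hy hg ⟨hx0.le, hy0.le⟩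
    have := (h z hz).1
    rw [hz0, abs_zero] at this
    linarith
  rcases hsign with hs | hs
  · exact Or.inl fun x hx => by have := h x hx; rwa [abs_of_nonneg (hs x hx)] at this
  · exact Or.inr fun x hx => by have := h x hx; rwa [abs_of_nonpos (hs x hx)] at this

/-- The phases on the integer points agree, up to a common sign, with an infinite sequence whose
fourth differences lie in the range of `|f⁗|`. -/
lemma exists_seq_of_contDiffOn {f : ℝ → ℝ} {N : ℤ} {L : ℕ} {W lam : ℝ} (hW : 0 < W)
    (hlam : 1 ≤ lam)
    (hf : ContDiffOn ℝ 4 f (Set.Icc ((N : ℝ) + 1) ((N : ℝ) + (L : ℝ))))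
    (hbound : 1 < L → ∀ x ∈ Set.Icc ((N : ℝ) + 1) ((N : ℝ) + (L : ℝ)),
      1 / W ≤ |iteratedDerivWithin 4 f (Set.Icc ((N : ℝ) + 1) ((N : ℝ) + (L : ℝ))) x| ∧
      |iteratedDerivWithin 4 f (Set.Icc ((N : ℝ) + 1) ((N : ℝ) + (L : ℝ))) x| ≤ lam / W) :
    ∃ b : ℕ → ℝ, ‖expSum f N L‖ = ‖seqSum b L‖ ∧
      ∀ n, (Δ_[1])^[4] b n ∈ Set.Icc (1 / W) (lam / W) := by
  have hd : 1 / W ∈ Set.Icc (1 / W) (lam / W) := ⟨le_rfl, by gcongr⟩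
  set I := Set.Icc ((N : ℝ) + 1) ((N : ℝ) + (L : ℝ)) with hI
  set a : ℕ → ℝ := fun n => f ((N : ℝ) + 1 + n) with ha
  have hext : ∀ a' : ℕ → ℝ, ‖seqSum a' L‖ = ‖seqSum a L‖ →
      (∀ n, n + 4 < L → (Δ_[1])^[4] a' n ∈ Set.Icc (1 / W) (lam / W)) →
      ∃ b : ℕ → ℝ, ‖expSum f N L‖ = ‖seqSum b L‖ ∧
        ∀ n, (Δ_[1])^[4] b n ∈ Set.Icc (1 / W) (lam / W) := by
    intro a' hnorm h
    obtain ⟨b, hb, hP⟩ := exists_extension_fwdDiff_iter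
      (P := fun y => y ∈ Set.Icc (1 / W) (lam / W)) hd 4 a' L h
    refine ⟨b, ?_, hP⟩
    rw [expSum_eq_seqSum, ← hnorm, seqSum, seqSum]
    congr 1
    exact sum_congr rfl fun n hn => by rw [hb n (mem_range.1 hn)]
  rcases Nat.lt_or_ge 1 L with hL | hL
  swap
  · exact hext a rfl fun n hn => by omega
  have hL' : (1 : ℝ) < L := by exact_mod_cast hL
  have hu : UniqueDiffOn ℝ I := uniqueDiffOn_Icc (by linarith)
  have hderiv : ∀ i < 4, ∀ x ∈ I,
      HasDerivWithinAt (iteratedDerivWithin i f I) (iteratedDerivWithin (i + 1) f I x) I x := by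
    intro i hi x hx
    rw [iteratedDerivWithin_succ]
    exact (hf.differentiableOn_iteratedDerivWithin (by exact_mod_cast hi) hu x hx).hasDerivWithinAt
  have hcont : ContinuousOn (iteratedDerivWithin 4 f I) I :=
    hf.continuousOn_iteratedDerivWithin le_rfl hu
  have hpt : ∀ n : ℕ, n + 4 < L → (N : ℝ) + 1 + n + (4 : ℕ) ≤ N + L := by
    intro n hn
    have : (n : ℝ) + 4 + 1 ≤ L := by exact_mod_cast hn
    push_cast; linarith
  rcases forall_mem_Icc_or_neg_mem_Icc (by positivity) hcont (hbound hL) with h | h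
  · refine hext a rfl fun n hn => ?_
    rw [ha, fwdDiff_iter_sample]
    have := fwdDiff_iter_mem_of_hasDerivWithinAt 4 (fun i => iteratedDerivWithin i f I) _ hderiv h
      ((N : ℝ) + 1 + n) (by simp) (hpt n hn)
    simpa only [iteratedDerivWithin_zero] using this
  · refine hext (-a) (norm_seqSum_neg a L) fun n hn => ?_
    have e : -a = fun n : ℕ => (-f) ((N : ℝ) + 1 + n) := rfl
    rw [e, fwdDiff_iter_sample]
    have := fwdDiff_iter_mem_of_hasDerivWithinAt 4 (fun i => -iteratedDerivWithin i f I) _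
      (fun i hi x hx => (hderiv i hi x hx).neg) h ((N : ℝ) + 1 + n) (by simp) (hpt n hn)
    simpa only [iteratedDerivWithin_zero] using this

end FourthDerivativeTest

theorem mainTheorem4 (f : ℝ → ℝ) (N : ℤ) (L : ℕ) (W₄ lam₄ η₃ η₄ : ℝ)
    (hW : 1 < W₄) (hlam : 1 ≤ lam₄) (hη₃ : 0 < η₃) (hη₄ : 0 < η₄)
    (hf : ContDiffOn ℝ 4 f (Set.Icc ((N : ℝ) + 1) ((N : ℝ) + (L : ℝ))))
    (hbound : 1 < L → ∀ x ∈ Set.Icc ((N : ℝ) + 1) ((N : ℝ) + (L : ℝ)),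
      1 / W₄ ≤ |iteratedDerivWithin 4 f (Set.Icc ((N : ℝ) + 1) ((N : ℝ) + (L : ℝ))) x| ∧
      |iteratedDerivWithin 4 f (Set.Icc ((N : ℝ) + 1) ((N : ℝ) + (L : ℝ))) x| ≤ lam₄ / W₄) :
    ‖FourthDerivativeTest.expSum f N L‖ ^ 2 ≤
      ((L : ℝ) * W₄ ^ (-(1 / 7) : ℝ) + η₄) *
        (FourthDerivativeTest.alpha4 η₃ η₄ lam₄ W₄ * (L : ℝ)
          + FourthDerivativeTest.gamma4 η₃ η₄ lam₄ W₄ * √(L : ℝ) * W₄ ^ (2 / 7 : ℝ)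
          + FourthDerivativeTest.beta4 η₃ η₄ * W₄ ^ (3 / 7 : ℝ)) := by
  have hW0 : 0 < W₄ := by linarith
  obtain ⟨b, hb, hdiff⟩ := FourthDerivativeTest.exists_seq_of_contDiffOn hW0 hlam hf hbound
  -- All exponents of `W₄` in the bound are multiples of `1 / 42`.
  set v := W₄ ^ (1 / 42 : ℝ) with hv
  have hv0 : 0 < v := by positivity
  have h42 : v ^ 42 = W₄ := by rw [hv, ← Real.rpow_mul_natCast hW0.le]; norm_num
  have h6 : W₄ ^ (-(1 / 7) : ℝ) = 1 / v ^ 6 := by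
    rw [Real.rpow_neg hW0.le, hv, ← Real.rpow_mul_natCast hW0.le]; norm_num
  have h12 : W₄ ^ (2 / 7 : ℝ) = v ^ 12 := by rw [hv, ← Real.rpow_mul_natCast hW0.le]; norm_num
  have h18 : W₄ ^ (3 / 7 : ℝ) = v ^ 18 := by rw [hv, ← Real.rpow_mul_natCast hW0.le]; norm_num
  rw [← h42] at hdiff
  have := FourthDerivativeTest.norm_seqSum_sq_le_of_fourth_fwdDiff hv0 hlam hη₃ hη₄ hdiff L
  rw [hb, FourthDerivativeTest.alpha4, FourthDerivativeTest.gamma4, FourthDerivativeTest.beta4,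
    h6, h12, h18, mul_one_div]
  exact this
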